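/- Let $p$ be a prime and $k\ge 1$ an integer. For a finite group $G$ let $\operatorname{Irr}(G)$ be its set of irreducible complex characters. Let $P_p=C_p$ be the cyclic group of order $p$, let $\phi_0,\phi_1,\dots,\phi_{p-1}$ be its irreducible characters in any order with $\phi_0$ trivial, and for $k\ge 2$ let $P_{p^k}=P_{p^{k-1}}\wr C_p=(P_{p^{k-1}})^{\times p}\rtimes C_p$, embedded in the usual (imprimitive) way as a Sylow $p$-subgroup of the symmetric group $S_{p^k}$. For a character $\phi$ of a group $K$ afforded by a module $W$, and a character $\psi$ of $C_p$, let $\mathcal X(\phi;\psi)$ be the character of $K\wr C_p$ obtained by multiplying the inflation of $\psi$ by the character of the module $W^{\otimes p}$, on which $(x_1,\dots,x_p;h)$ acts by $v_1\otimes\cdots\otimes v_p\mapsto x_1v_{h^{-1}(1)}\otimes\cdots\otimes x_pv_{h^{-1}(p)}$. Let $\mathcal F_k$ be the set of rooted complete $p$-ary trees of height $k-1$, with ordered children, whose vertices are labelled by elements of $\{0,1,\dots,p\}$. Write $(T_1\mid\cdots\mid T_p;\varepsilon)$ for the tree whose root has label $\varepsilon$ and whose subtrees under the root are $T_1,\dots,T_p$.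 Two trees in $\mathcal F_k$ are in the same orbit, written $[T]=[T']$, if one is obtained from the other by cyclically permuting, at each non-leaf vertex, the $p$ subtrees under it (an action of the $(k-1)$-fold wreath product $C_p\wr\cdots\wr C_p$). To each $\theta\in\operatorname{Irr}(P_{p^k})$ associate an orbit $\mathcal T(\theta)$ of trees in $\mathcal F_k$ recursively as follows. If $k=1$, then $\mathcal T(\phi_\varepsilon)$ consists of the single vertex with label $\varepsilon$. If $k\ge 2$, then * $\mathcal T(\theta)=[(T_1\mid\cdots\mid T_p;\varepsilon)]$ with $T_i\in\mathcal T(\phi)$ for all $i$, if $\theta=\mathcal X(\phi;\phi_\varepsilon)$ for some $\phi\in\operatorname{Irr}(P_{p^{k-1}})$ and $0\le\varepsilon\le p-1$; * $\mathcal T(\theta)=[(T_1\mid\cdots\mid T_p;p)]$ with $T_i\in\mathcal T(\theta_i)$ for all $i$, if $\theta=(\theta_1\times\cdots\times\theta_p)\big\uparrow_{(P_{p^{k-1}})^{\times p}}^{P_{p^k}}$ for some $\theta_1,\dots,\theta_p\in\operatorname{Irr}(P_{p^{k-1}})$ that are not all equal. For $\theta,\zeta\in\operatorname{Irr}(P_{p^k})$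 write $\theta\sim_{0,p}\zeta$ if some tree in $\mathcal T(\zeta)$ can be obtained from some tree in $\mathcal T(\theta)$ by a finite (possibly empty) sequence of steps, each of which replaces the label of one vertex, lying in $\{1,\dots,p-1\}$, by another element of $\{1,\dots,p-1\}$ (the intermediate trees need not correspond to characters). Finally, let $\Omega(\theta)$ be the set of all $\chi\in\operatorname{Irr}(S_{p^k})$ with $[\chi\big\downarrow_{P_{p^k}},\theta]\ne 0$, where $[\cdot,\cdot]$ is the usual inner product of characters. **Theorem.** Let $\theta,\zeta\in\operatorname{Irr}(P_{p^k})$. If $\theta\sim_{0,p}\zeta$, then $\theta\big\uparrow^{S_{p^k}}=\zeta\big\uparrow^{S_{p^k}}$. In particular, $\Omega(\theta)=\Omega(\zeta)$. -/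

import Mathlib

open scoped TensorProduct

namespace SylowTrees

/-! ### Characters of finite groups -/

/-- The set `Irr(G)` of irreducible complex characters of `G`, as functions `G → ℂ`. -/
def Irr (G : Type*) [Group G] : Set (G → ℂ) :=
  {χ | ∃ (m : ℕ) (ρ : Representation ℂ G (Fin m → ℂ)), ρ.IsIrreducible ∧ ρ.character = χ}

/-- The induced class function along a homomorphism `f : H → G` of finite groups (in practice `f` is
injective and identifies `H` with a subgroup of `G`):
`(θ↑G)(g) = |H|⁻¹ ∑_{x ∈ G} ∑_{h ∈ H, f(h) = x⁻¹gx} θ(h)`. -/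
noncomputable def indChar {H G : Type*} [Group H] [Group G] [Finite H] [Finite G]
    (f : H →* G) (θ : H → ℂ) : G → ℂ :=
  fun g => (Nat.card H : ℂ)⁻¹ * ∑ᶠ x : G, ∑ᶠ h : {h : H // f h = x⁻¹ * g * x}, θ h

/-- The inner product `[χ, θ] = |H|⁻¹ ∑_{h ∈ H} χ(h) \overline{θ(h)}`. -/
noncomputable def charInner {H : Type*} [Group H] [Finite H] (χ θ : H → ℂ) : ℂ :=
  (Nat.card H : ℂ)⁻¹ * ∑ᶠ h : H, χ h * (starRingEnd ℂ) (θ h)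

/-- `Ω(θ)`: the set of `χ ∈ Irr(G)` with `[χ↓H, θ] ≠ 0`, where `H` is regarded as a subgroup of `G`
through `f`. -/
def Omega {H G : Type*} [Group H] [Group G] [Finite H] (f : H →* G) (θ : H → ℂ) : Set (G → ℂ) :=
  {χ | χ ∈ Irr G ∧ charInner (fun h => χ (f h)) θ ≠ 0}

/-! ### Characters of wreath products -/

section Wreath

variable {K Q V : Type*} [Group K] [Group Q] [AddCommGroup V] [Module ℂ V]

/-- The inclusion of the base group `K^Q` into `K ≀ Q`. -/
def baseHom (K Q : Type*) [Group K] [Group Q] : (Q → K) →* RegularWreathProduct K Q where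
  toFun x := ⟨x, 1⟩
  map_one' := rfl
  map_mul' x y := by ext <;> simp

/-- The external product character `∏_q θ_q` of the base group `K^Q`. -/
def prodChar [Fintype Q] (θ : Q → K → ℂ) : (Q → K) → ℂ :=
  fun x => ∏ q, θ q (x q)

/-- The linear map `⨂_q v_q ↦ ⨂_q x_q v_{h⁻¹ q}` on `V^{⊗ Q}` given by `(x; h) ∈ K ≀ Q`. -/
noncomputable def tensorMap (ρ : Representation ℂ K V) (g : RegularWreathProduct K Q) :
    (⨂[ℂ] _ : Q, V) →ₗ[ℂ] (⨂[ℂ] _ : Q, V) :=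
  (PiTensorProduct.map (fun q => ρ (g.left q))).comp
    (PiTensorProduct.reindex ℂ (fun _ : Q => V) (Equiv.mulLeft g.right)).toLinearMap

theorem tensorMap_tprod (ρ : Representation ℂ K V) (g : RegularWreathProduct K Q) (v : Q → V) :
    tensorMap ρ g (PiTensorProduct.tprod ℂ v) =
      PiTensorProduct.tprod ℂ (fun q => ρ (g.left q) (v (g.right⁻¹ * q))) := by
  have h := PiTensorProduct.reindex_tprod (R := ℂ) (s := fun _ : Q => V)
    (Equiv.mulLeft g.right) v
  have h' := PiTensorProduct.map_tprod (fun q => ρ (g.left q))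
    (fun q => v ((Equiv.mulLeft g.right).symm q))
  exact (congrArg (PiTensorProduct.map (fun q => ρ (g.left q))) h).trans h'

/-- The `K ≀ Q`-module `V^{⊗ Q}` extending the `K^Q`-module `V^{⊗ Q}`. -/
noncomputable def tensorRep (Q : Type*) [Group Q] (ρ : Representation ℂ K V) :
    Representation ℂ (RegularWreathProduct K Q) (⨂[ℂ] _ : Q, V) where
  toFun g := tensorMap ρ g
  map_one' := by
    refine PiTensorProduct.ext (MultilinearMap.ext fun v => ?_)
    simp [tensorMap_tprod]
  map_mul' a b := by
    refine PiTensorProduct.ext (MultilinearMap.ext fun v => ?_)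
    simp [tensorMap_tprod, mul_assoc]

/-- The character `𝒳(χ; ψ)` of `K ≀ Q`, where `χ` is the character of `ρ`: the character of the
module `V^{⊗ Q}` times the inflation of `ψ` along `K ≀ Q → Q`. -/
noncomputable def wreathChar (ρ : Representation ℂ K V) (ψ : Q → ℂ) :
    RegularWreathProduct K Q → ℂ :=
  fun g => (tensorRep Q ρ).character g * ψ g.right

end Wreath

/-! ### The Sylow `p`-subgroup of the symmetric group of degree `p ^ k` -/

/-- The cyclic group of order `p`. It also serves as the index set, with `p` elements, that the
cyclic group permutes by translation. -/
abbrev Cyc (p : ℕ) : Type := Multiplicative (ZMod p)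

/-- The `k`-fold wreath product `C_p ≀ ⋯ ≀ C_p`. -/
abbrev P (p k : ℕ) : Type := IteratedWreathProduct (Cyc p) k

/-- The embedding of the `k`-fold wreath product `C_p ≀ ⋯ ≀ C_p` in the symmetric group of degree
`p ^ k`, by its imprimitive action on `C_p ^ k`, the points of which are numbered by `e`. -/
def sylowHom {p k : ℕ} (e : (Fin k → Cyc p) ≃ Fin (p ^ k)) :
    P p k →* Equiv.Perm (Fin (p ^ k)) :=
  e.permCongrHom.toMonoidHom.comp (iteratedWreathToPermHom (Cyc p) k)

theorem sylowHom_injective {p k : ℕ} (e : (Fin k → Cyc p) ≃ Fin (p ^ k)) :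
    Function.Injective (sylowHom e) :=
  e.permCongrHom.injective.comp (iteratedWreathToPermHomInj (Cyc p) k)

/-- The image of the embedding is a Sylow `p`-subgroup. -/
theorem exists_sylow_eq_range {p k : ℕ} [Fact p.Prime] (e : (Fin k → Cyc p) ≃ Fin (p ^ k)) :
    ∃ S : Sylow p (Equiv.Perm (Fin (p ^ k))), (S : Subgroup _) = (sylowHom e).range := by
  have hp : p.Prime := Fact.out
  refine ⟨Sylow.ofCard (sylowHom e).range ?_, rfl⟩
  have hC : Nat.card (Cyc p) = p := by simp [Cyc]
  rw [← Nat.card_congr (MonoidHom.ofInjective (sylowHom_injective e)).toEquiv,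
    IteratedWreathProduct.card, hC, Nat.card_perm, Nat.card_fin,
    ← Nat.multiplicity_eq_factorization hp (p ^ k).factorial_ne_zero,
    Nat.Prime.multiplicity_factorial_pow hp]

/-! ### Labelled trees -/

/-- Rooted complete `p`-ary trees of height `h` with vertices labelled by `{0, 1, …, p}`. The
children of a vertex are indexed by `Cyc p`. -/
inductive PTree (p : ℕ) : ℕ → Type
  | leaf (ε : Fin (p + 1)) : PTree p 0
  | node {h : ℕ} (S : Cyc p → PTree p h) (ε : Fin (p + 1)) : PTree p (h + 1)

/-- The action of the `h`-fold wreath product `C_p ≀ ⋯ ≀ C_p` on labelled trees of height `h`,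
permuting cyclically the subtrees under each vertex that is not a leaf. -/
def PTree.act {p : ℕ} : {h : ℕ} → P p h → PTree p h → PTree p h
  | 0, _, T => T
  | _ + 1, g, .node S ε =>
      .node (fun i => PTree.act (RegularWreathProduct.left g i)
        (S ((RegularWreathProduct.right g)⁻¹ * i))) ε

/-- The orbit `[T]`. -/
def PTree.orbit {p h : ℕ} (T : PTree p h) : Set (PTree p h) :=
  Set.range (fun g : P p h => PTree.act g T)

/-- The set `𝒯(θ)` of trees of a character `θ` of the `(h+1)`-fold wreath product
`C_p ≀ ⋯ ≀ C_p`, where `φ` lists the irreducible characters of `C_p`. -/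
def trees {p : ℕ} [Fact p.Prime] (φ : Fin p ≃ Irr (Cyc p)) :
    (h : ℕ) → (P p (h + 1) → ℂ) → Set (PTree p h)
  | 0, θ => {T | ∃ j : Fin p,
      θ = (fun g => (φ j : Cyc p → ℂ) (RegularWreathProduct.right g)) ∧ T = .leaf j.castSucc}
  | h + 1, θ => {T |
      (∃ (m : ℕ) (ρ : Representation ℂ (P p (h + 1)) (Fin m → ℂ)) (j : Fin p)
          (S : Cyc p → PTree p h),
        ρ.IsIrreducible ∧ θ = wreathChar ρ (φ j : Cyc p → ℂ) ∧
        (∀ i, S i ∈ trees φ h ρ.character) ∧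
        T ∈ (PTree.node S j.castSucc).orbit) ∨
      (∃ (θs : Cyc p → P p (h + 1) → ℂ) (S : Cyc p → PTree p h),
        (∀ i, θs i ∈ Irr (P p (h + 1))) ∧ (¬ ∀ i j, θs i = θs j) ∧
        θ = indChar (baseHom (P p (h + 1)) (Cyc p)) (prodChar θs) ∧
        (∀ i, S i ∈ trees φ h (θs i)) ∧
        T ∈ (PTree.node S (Fin.last p)).orbit)}

/-- A label lies in `[1, p - 1]`. -/
def IsMiddle {p : ℕ} (ε : Fin (p + 1)) : Prop := 1 ≤ (ε : ℕ) ∧ (ε : ℕ) < p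

/-- A good label replacement: the label of one vertex, lying in `[1, p - 1]`, is replaced by some
label in `[1, p - 1]`. -/
def GoodReplacement {p : ℕ} : {h : ℕ} → PTree p h → PTree p h → Prop
  | 0, .leaf ε, .leaf δ => IsMiddle ε ∧ IsMiddle δ
  | _ + 1, .node S ε, .node S' δ =>
      (S = S' ∧ IsMiddle ε ∧ IsMiddle δ) ∨
      (ε = δ ∧ ∃ i, GoodReplacement (S i) (S' i) ∧ ∀ j, j ≠ i → S j = S' j)

/-- The relation `θ ∼ ζ`: some tree of `ζ` is obtained from some tree of `θ` by a sequence of good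
label replacements. -/
def LabelEquiv {p : ℕ} [Fact p.Prime] (φ : Fin p ≃ Irr (Cyc p)) {h : ℕ}
    (θ ζ : P p (h + 1) → ℂ) : Prop :=
  ∃ T ∈ trees φ h θ, ∃ T' ∈ trees φ h ζ, Relation.ReflTransGen GoodReplacement T T'

end SylowTrees

namespace SylowTrees

/-! ### Induced class functions -/

section Induction

variable {H G L : Type*} [Group H] [Group G] [Group L]

/-! Compare trees up to the values of labels in [1, p - 1] (`TreeSim`) and induct on height: similar
trees give equal inductions to G = Sym(C_p^k) (`indChar_iterHom_eq_of_treeSim`). The inductive step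
works because the embedding of P_{p^k} ≀ C_p in Sym(C_p^{k+1}) factors through G ≀ C_p.

If the root label is p, the character is induced from the base group. Routing this induction through
the base group of G ≀ C_p shows that the result depends only on the characters θ_i↑G, and a cyclic
shift of the θ_i changes nothing.

If the root label is below p, the crux is `indChar_wreathChar_congr`: inducing 𝒳(χ; ψ) to G ≀ C_p
gives something depending only on ψ and χ↑G. Over h ≠ 1 in C_p the trace on the tensor power is the
trace of one product of matrices along the cycle of h. Summing over conjugators replaces these by
matrices of the induced representation, so χ↑G at a cyclic product appears; over h = 1 a product of
values of χ↑G appears. To change ψ, note that nontrivial characters of C_p differ by an automorphism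
of C_p, which becomes conjugation in Sym(C_p^{k+1}) (`imprimitiveHom_topAut`).

The statement about Ω follows by Frobenius reciprocity (`Omega_congr`). -/

theorem indChar_apply [Fintype H] [Fintype G] [DecidableEq G] (f : H →* G) (θ : H → ℂ) (g : G) :
    indChar f θ g =
      (Nat.card H : ℂ)⁻¹ * ∑ x : G, ∑ h : H, if f h = x⁻¹ * g * x then θ h else 0 := by
  classical
  unfold indChar
  rw [finsum_eq_sum_of_fintype]
  congr 1
  refine Finset.sum_congr rfl fun x _ => ?_
  rw [finsum_eq_sum_of_fintype, ← Finset.sum_filter]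
  exact (Finset.sum_subtype _ (by simp) _).symm

variable [Finite H] [Finite G] [Finite L]

theorem card_ne_zero_complex (H : Type*) [Group H] [Finite H] : (Nat.card H : ℂ) ≠ 0 :=
  Nat.cast_ne_zero.mpr Nat.card_pos.ne'

/-- Transitivity of induction. -/
theorem indChar_comp (g : G →* L) (f : H →* G) (θ : H → ℂ) :
    indChar (g.comp f) θ = indChar g (indChar f θ) := by
  classical
  cases nonempty_fintype H
  cases nonempty_fintype G
  cases nonempty_fintype L
  funext l
  simp only [indChar_apply, MonoidHom.comp_apply]
  have key : ∀ x : G, ∑ y : L, ∑ k : G, ∑ h : H,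
      (if g k = y⁻¹ * l * y then if f h = x⁻¹ * k * x then θ h else 0 else 0) =
      ∑ y : L, ∑ h : H, if g (f h) = y⁻¹ * l * y then θ h else 0 := by
    intro x
    have inner : ∀ y : L, ∑ k : G, ∑ h : H,
        (if g k = y⁻¹ * l * y then if f h = x⁻¹ * k * x then θ h else 0 else 0) =
        ∑ h : H, if g (f h) = (y * g x)⁻¹ * l * (y * g x) then θ h else 0 := by
      intro y
      rw [Finset.sum_comm]
      refine Finset.sum_congr rfl fun h _ => ?_
      rw [Finset.sum_eq_single (x * f h * x⁻¹)]
      · have e : (g (x * f h * x⁻¹) = y⁻¹ * l * y) ↔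
            (g (f h) = (y * g x)⁻¹ * l * (y * g x)) := by
          simp only [map_mul, map_inv]
          constructor
          · intro e
            have := congrArg (fun u => (g x)⁻¹ * u * g x) e
            simpa [mul_assoc] using this
          · intro e
            rw [e]
            group
        simp only [e]
        simp [mul_assoc]
      · intro k _ hk
        have : f h ≠ x⁻¹ * k * x := by
          intro e
          exact hk (by rw [e]; group)
        simp [this]
      · simp
    simp only [inner]
    -- Translating y by g x removes the dependence on x, so the sum over x only contributes the
    -- factor |G|.
    exact Fintype.sum_equiv (Equiv.mulRight (g x)) _ _ fun y => rfl
  have swap : ∑ y : L, ∑ k : G, (if g k = y⁻¹ * l * y then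
      (Nat.card H : ℂ)⁻¹ * ∑ x : G, ∑ h : H, (if f h = x⁻¹ * k * x then θ h else 0) else 0) =
      (Nat.card H : ℂ)⁻¹ * ∑ x : G, ∑ y : L, ∑ k : G, ∑ h : H,
      (if g k = y⁻¹ * l * y then if f h = x⁻¹ * k * x then θ h else 0 else 0) := by
    rw [Finset.sum_comm (s := (Finset.univ : Finset G)), Finset.mul_sum]
    refine Finset.sum_congr rfl fun y _ => ?_
    rw [Finset.sum_comm, Finset.mul_sum]
    refine Finset.sum_congr rfl fun k _ => ?_
    split_ifs <;> simp
  rw [swap]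
  simp only [key, Finset.sum_const, Finset.card_univ, nsmul_eq_mul, ← Nat.card_eq_fintype_card]
  have := card_ne_zero_complex G
  field_simp

/-- Twisting by an automorphism that becomes inner in the larger group does not change the induced
class function. -/
theorem indChar_comp_mulEquiv (f : H →* G) (α : H ≃* H) (t : G)
    (hα : ∀ h, f (α h) = t * f h * t⁻¹) (θ : H → ℂ) :
    indChar f (fun h => θ (α h)) = indChar f θ := by
  classical
  cases nonempty_fintype H
  cases nonempty_fintype G
  funext g
  rw [indChar_apply, indChar_apply]
  congr 1
  refine Fintype.sum_equiv (Equiv.mulRight t⁻¹) _ _ fun x => ?_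
  refine Fintype.sum_equiv α.toEquiv _ _ fun h => ?_
  have e : f h = x⁻¹ * g * x ↔
      f (α h) = (x * t⁻¹)⁻¹ * g * (x * t⁻¹) := by
    rw [hα]
    constructor
    · intro e
      rw [e]
      group
    · intro e
      have := congrArg (fun u => t⁻¹ * u * t) e
      simpa [mul_assoc] using this
  simp [e]

/-- Frobenius reciprocity. -/
theorem charInner_indChar (f : H →* G) (θ : H → ℂ) (χ : G → ℂ)
    (hχ : ∀ x g, χ (x * g * x⁻¹) = χ g) :
    charInner χ (indChar f θ) = charInner (fun h => χ (f h)) θ := by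
  classical
  cases nonempty_fintype H
  cases nonempty_fintype G
  unfold charInner
  rw [finsum_eq_sum_of_fintype, finsum_eq_sum_of_fintype]
  have inner : ∀ x : G, ∑ g : G, ∑ h : H,
      χ g * (starRingEnd ℂ) (if f h = x⁻¹ * g * x then θ h else 0) =
      ∑ h : H, χ (f h) * (starRingEnd ℂ) (θ h) := by
    intro x
    rw [Finset.sum_comm]
    refine Finset.sum_congr rfl fun h _ => ?_
    rw [Finset.sum_eq_single (x * f h * x⁻¹)]
    · rw [hχ, if_pos (by group)]
    · intro k _ hk
      have : f h ≠ x⁻¹ * k * x := by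
        intro e
        exact hk (by rw [e]; group)
      simp [this]
    · simp
  have swap : ∑ g : G, χ g * (starRingEnd ℂ) (indChar f θ g) =
      (Nat.card H : ℂ)⁻¹ * ∑ x : G, ∑ g : G, ∑ h : H,
      χ g * (starRingEnd ℂ) (if f h = x⁻¹ * g * x then θ h else 0) := by
    rw [Finset.sum_comm, Finset.mul_sum]
    refine Finset.sum_congr rfl fun g _ => ?_
    rw [indChar_apply]
    simp only [map_mul, map_inv₀, Complex.conj_natCast, map_sum, Finset.mul_sum]
    refine Finset.sum_congr rfl fun x _ => Finset.sum_congr rfl fun h _ => ?_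
    ring
  rw [swap]
  simp only [inner, Finset.sum_const, Finset.card_univ, nsmul_eq_mul, ← Nat.card_eq_fintype_card]
  have := card_ne_zero_complex G
  field_simp

/-- `Ω(θ)` depends only on the induced class function of `θ`. -/
theorem Omega_congr (f : H →* G) {θ ζ : H → ℂ} (h : indChar f θ = indChar f ζ) :
    Omega f θ = Omega f ζ := by
  ext χ
  refine and_congr_right ?_
  rintro ⟨m, ρ, -, rfl⟩
  have hc : ∀ x g, ρ.character (x * g * x⁻¹) = ρ.character g := fun x g => ρ.char_conj g x
  rw [← charInner_indChar f θ _ hc, ← charInner_indChar f ζ _ hc, h]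

/-- Induction commutes with external products. -/
theorem indChar_prodChar {Q : Type*} [Fintype Q] (f : H →* G) (θ : Q → H → ℂ) :
    indChar (f.compLeft Q) (prodChar θ) =
      prodChar fun q => indChar f (θ q) := by
  classical
  cases nonempty_fintype H
  cases nonempty_fintype G
  funext g
  unfold prodChar
  simp only [indChar_apply, Finset.prod_mul_distrib, Finset.prod_univ_sum, Fintype.piFinset_univ]
  congr 1
  · simp
  · refine Finset.sum_congr rfl fun x _ => Finset.sum_congr rfl fun h _ => ?_
    rw [Finset.prod_ite_zero]
    simp [funext_iff]

end Induction

/-! ### Permuted products of matrix entries -/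

section CyclicTrace

variable {ι : Type*} [Fintype ι]

/-- The trace of `(⨂_q A_q) ∘ (permutation of the tensor factors by h)`. -/
noncomputable def permTrace {Q : Type*} [Fintype Q] [DecidableEq Q] [Group Q]
    (A : Q → Matrix ι ι ℂ) (h : Q) : ℂ :=
  ∑ b : Q → ι, ∏ q, A q (b q) (b (h⁻¹ * q))

theorem permTrace_one {Q : Type*} [Fintype Q] [DecidableEq Q] [Group Q]
    (A : Q → Matrix ι ι ℂ) : permTrace A 1 = ∏ q, (A q).trace := by
  simp [permTrace, Matrix.trace, Finset.prod_univ_sum, Fintype.piFinset_univ]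

/-- Relabelling by an automorphism. -/
theorem permTrace_comp_mulEquiv {Q : Type*} [Fintype Q] [DecidableEq Q] [Group Q]
    (A : Q → Matrix ι ι ℂ) (τ : Q ≃* Q) (h : Q) :
    permTrace (fun q => A (τ.symm q)) (τ h) = permTrace A h := by
  unfold permTrace
  refine (Fintype.sum_equiv (τ.toEquiv.arrowCongr (Equiv.refl ι)) _ _ fun b => ?_).symm
  refine Fintype.prod_equiv τ.toEquiv _ _ fun q => ?_
  simp

/-- Expansion of the entries of a product of matrices as a sum over paths. -/
theorem sum_path_prod [DecidableEq ι] (n : ℕ) (A : Fin n → Matrix ι ι ℂ) (g : ι → ι → ℂ) :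
    ∑ b : Fin (n + 1) → ι, (∏ i : Fin n, A i (b i.castSucc) (b i.succ)) * g (b 0) (b (Fin.last n)) =
      ∑ a, ∑ c, (List.ofFn A).prod a c * g a c := by
  -- The endpoint weight g must vary: the inductive step absorbs the last matrix into it.
  induction n generalizing g with
  | zero =>
    rw [Fintype.sum_equiv (Equiv.funUnique (Fin 1) ι) _ (fun a => g a a) (by intro b; simp)]
    simp [Matrix.one_apply]
  | succ n ih =>
    have step : ∀ b : Fin (n + 1) → ι, ∑ d : ι,
        (∏ i : Fin (n + 1), A i ((Fin.snoc b d : Fin (n + 2) → ι) i.castSucc)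
          ((Fin.snoc b d : Fin (n + 2) → ι) i.succ)) *
          g ((Fin.snoc b d : Fin (n + 2) → ι) 0)
            ((Fin.snoc b d : Fin (n + 2) → ι) (Fin.last (n + 1))) =
        (∏ i : Fin n, A i.castSucc (b i.castSucc) (b i.succ)) *
          ∑ d, A (Fin.last n) (b (Fin.last n)) d * g (b 0) d := by
      intro b
      rw [Finset.mul_sum]
      refine Finset.sum_congr rfl fun d _ => ?_
      have h0 : (Fin.snoc b d : Fin (n + 2) → ι) 0 = b 0 :=
        Fin.snoc_castSucc (α := fun _ => ι) d b 0
      rw [Fin.prod_univ_castSucc, h0]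
      simp only [Fin.succ_castSucc, Fin.snoc_castSucc, Fin.snoc_last, Fin.succ_last]
      ring
    have split := Fintype.sum_equiv (Fin.snocEquiv fun _ : Fin (n + 2) => ι).symm
      (fun b : Fin (n + 2) → ι => (∏ i : Fin (n + 1), A i (b i.castSucc) (b i.succ)) *
        g (b 0) (b (Fin.last (n + 1))))
      (fun x => (∏ i : Fin (n + 1), A i ((Fin.snoc x.2 x.1 : Fin (n + 2) → ι) i.castSucc)
          ((Fin.snoc x.2 x.1 : Fin (n + 2) → ι) i.succ)) *
          g ((Fin.snoc x.2 x.1 : Fin (n + 2) → ι) 0)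
            ((Fin.snoc x.2 x.1 : Fin (n + 2) → ι) (Fin.last (n + 1))))
      (by
        intro b
        have hb : (Fin.snoc ((Fin.snocEquiv fun _ : Fin (n + 2) => ι).symm b).2
            ((Fin.snocEquiv fun _ : Fin (n + 2) => ι).symm b).1 : Fin (n + 2) → ι) = b :=
          (Fin.snocEquiv fun _ : Fin (n + 2) => ι).apply_symm_apply b
        rw [hb])
    rw [split, Fintype.sum_prod_type, Finset.sum_comm]
    simp only [step]
    rw [ih (fun i => A i.castSucc) fun a c => ∑ d, A (Fin.last n) c d * g a d, List.ofFn_succ',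
      List.concat_eq_append, List.prod_append, List.prod_singleton]
    refine Finset.sum_congr rfl fun a _ => ?_
    simp only [Matrix.mul_apply, Finset.mul_sum, Finset.sum_mul]
    rw [Finset.sum_comm]
    refine Finset.sum_congr rfl fun c _ => Finset.sum_congr rfl fun d _ => ?_
    ring

theorem trace_prod_ofFn [DecidableEq ι] (n : ℕ) (A : Fin (n + 1) → Matrix ι ι ℂ) :
    (List.ofFn A).prod.trace = ∑ b : Fin (n + 1) → ι, ∏ i, A i (b i) (b (i + 1)) := by
  -- Taking the last matrix, arguments swapped, as endpoint weight closes the path into a cycle; `i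
  -- + 1` wraps around in `Fin (n + 1)`.
  have h := sum_path_prod n (fun i => A i.castSucc) fun a c => A (Fin.last n) c a
  rw [List.ofFn_succ', List.concat_eq_append, List.prod_append, List.prod_singleton]
  simp only [Matrix.trace, Matrix.diag, Matrix.mul_apply]
  rw [← h]
  refine Finset.sum_congr rfl fun b _ => ?_
  rw [Fin.prod_univ_castSucc]
  simp [Fin.coeSucc_eq_succ]

/-- If the powers of `h⁻¹` enumerate `Q`, the permuted product of matrix entries is the trace of a
product of matrices. -/
theorem permTrace_eq_trace_prod [DecidableEq ι] {Q : Type*} [Fintype Q] [DecidableEq Q] [Group Q]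
    {n : ℕ} (σ : Fin (n + 1) ≃ Q) (h : Q) (hσ : ∀ i, σ (i + 1) = h⁻¹ * σ i)
    (A : Q → Matrix ι ι ℂ) :
    permTrace A h = (List.ofFn fun i => A (σ i)).prod.trace := by
  rw [trace_prod_ofFn]
  unfold permTrace
  refine Fintype.sum_equiv (σ.symm.arrowCongr (Equiv.refl ι)) _ _ fun b => ?_
  refine Fintype.prod_equiv σ.symm _ _ fun q => ?_
  simp [hσ]

end CyclicTrace

/-- The powers of a nontrivial element enumerate the cyclic group of prime order `p`. -/
theorem exists_equiv_powers {p n : ℕ} [Fact p.Prime] (hn : p = n + 1) (h : Cyc p) (hh : h ≠ 1) :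
    ∃ σ : Fin (n + 1) ≃ Cyc p, ∀ i, σ (i + 1) = h⁻¹ * σ i := by
  have hcard : Nat.card (Cyc p) = p := by simp [Cyc]
  have hord : orderOf h⁻¹ = n + 1 := by
    rw [orderOf_inv, ← hn]
    refine orderOf_eq_prime ?_ hh
    have := pow_card_eq_one' (x := h)
    rwa [hcard] at this
  have hinj : Function.Injective fun i : Fin (n + 1) => h⁻¹ ^ (i : ℕ) := by
    intro i j hij
    have := pow_injOn_Iio_orderOf (x := h⁻¹) (by simp [hord, i.is_le]) (by simp [hord, j.is_le]) hij
    exact Fin.ext this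
  have hbij : Function.Bijective fun i : Fin (n + 1) => h⁻¹ ^ (i : ℕ) := by
    refine (Fintype.bijective_iff_injective_and_card _).mpr ⟨hinj, ?_⟩
    rw [← Nat.card_eq_fintype_card, ← Nat.card_eq_fintype_card, hcard, Nat.card_fin, hn]
  refine ⟨Equiv.ofBijective _ hbij, fun i => ?_⟩
  change h⁻¹ ^ ((i + 1 : Fin (n + 1)) : ℕ) = h⁻¹ * h⁻¹ ^ (i : ℕ)
  rw [← pow_succ', Fin.val_add, Fin.val_one', Nat.add_mod_mod]
  have := pow_mod_orderOf h⁻¹ (i + 1)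
  rwa [hord] at this

/-! ### Induction to wreath products -/

section InducedMatrix

variable {K G ι : Type*} [Group K] [Group G] [Fintype K] [Fintype G] [DecidableEq G]
  [Fintype ι] [DecidableEq ι]

/-- `|K|` times the matrix of the induced representation, compressed to the whole group. -/
noncomputable def indMatrix (f : K →* G) (R : K →* Matrix ι ι ℂ) (g : G) :
    Matrix (G × ι) (G × ι) ℂ :=
  fun a b => ∑ k : K, if f k = a.1⁻¹ * g * b.1 then R k a.2 b.2 else 0

/-- Rows are indexed by all of G rather than by coset representatives, which avoids choices at the
cost of a factor |K|: each k determines the intermediate index b, and substituting k * k' makes its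
contribution independent of k. -/
theorem indMatrix_mul (f : K →* G) (R : K →* Matrix ι ι ℂ) (g g' : G) :
    indMatrix f R g * indMatrix f R g' = (Nat.card K : ℂ) • indMatrix f R (g * g') := by
  ext ⟨a, i⟩ ⟨c, j⟩
  have inner : ∀ k : K, ∑ b : G, (if f k = a⁻¹ * g * b then
      ∑ k' : K, (if f k' = b⁻¹ * g' * c then (R k * R k') i j else 0) else 0) =
      ∑ k' : K, if f k' = a⁻¹ * (g * g') * c then R k' i j else 0 := by
    intro k
    rw [Finset.sum_eq_single (g⁻¹ * a * f k)]
    · rw [if_pos (by group)]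
      refine Fintype.sum_equiv (Equiv.mulLeft k) _ _ fun k' => ?_
      have e : f k' = (g⁻¹ * a * f k)⁻¹ * g' * c ↔ f (k * k') = a⁻¹ * (g * g') * c := by
        rw [map_mul]
        constructor
        · intro e
          rw [e]
          group
        · intro e
          have := congrArg (fun u => (f k)⁻¹ * u) e
          simpa [mul_assoc] using this
      simp only [e, Equiv.coe_mulLeft, map_mul R]
    · intro b _ hb
      rw [if_neg]
      intro e
      exact hb (by rw [e]; group)
    · simp
  have expand : (indMatrix f R g * indMatrix f R g') (a, i) (c, j) =
      ∑ k : K, ∑ b : G, (if f k = a⁻¹ * g * b then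
      ∑ k' : K, (if f k' = b⁻¹ * g' * c then (R k * R k') i j else 0) else 0) := by
    rw [Finset.sum_comm, Matrix.mul_apply, Fintype.sum_prod_type]
    refine Finset.sum_congr rfl fun b _ => ?_
    simp only [indMatrix, Finset.sum_mul_sum]
    rw [Finset.sum_comm]
    refine Finset.sum_congr rfl fun k _ => ?_
    rw [Finset.sum_comm]
    by_cases hk : f k = a⁻¹ * g * b
    · simp only [hk, if_true]
      refine Finset.sum_congr rfl fun k' _ => ?_
      split_ifs
      · rw [Matrix.mul_apply]
      · simp
    · simp [hk]
  rw [expand]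
  simp only [inner, Finset.sum_const, Finset.card_univ, nsmul_eq_mul, ← Nat.card_eq_fintype_card]
  rfl

/-- The list is kept nonempty because `indMatrix f R 1` need not be the identity; the exponent
counts multiplications, one fewer than the factors. -/
theorem prod_map_indMatrix (f : K →* G) (R : K →* Matrix ι ι ℂ) (g : G) (l : List G) :
    ((g :: l).map (indMatrix f R)).prod =
      (Nat.card K : ℂ) ^ l.length • indMatrix f R (g :: l).prod := by
  induction l generalizing g with
  | nil => simp
  | cons g' l ih =>
    rw [List.map_cons, List.prod_cons, ih, Matrix.mul_smul, indMatrix_mul, smul_smul,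
      List.length_cons, pow_succ, List.prod_cons (a := g)]

theorem trace_indMatrix (f : K →* G) (R : K →* Matrix ι ι ℂ) (g : G) :
    (indMatrix f R g).trace = Nat.card K * indChar f (fun k => (R k).trace) g := by
  rw [indChar_apply, mul_inv_cancel_left₀ (card_ne_zero_complex K)]
  simp only [Matrix.trace, Matrix.diag, indMatrix, Fintype.sum_prod_type]
  refine Finset.sum_congr rfl fun x _ => ?_
  rw [Finset.sum_comm]
  refine Finset.sum_congr rfl fun k _ => ?_
  split_ifs <;> simp

theorem permTrace_indMatrix_eq {Q : Type*} [Fintype Q] [DecidableEq Q] [Group Q] {n : ℕ}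
    (σ : Fin (n + 1) ≃ Q) (h : Q) (hσ : ∀ i, σ (i + 1) = h⁻¹ * σ i)
    (f : K →* G) (R : K →* Matrix ι ι ℂ) (y : Q → G) :
    permTrace (fun q => indMatrix f R (y q)) h = (Nat.card K : ℂ) ^ n *
      (Nat.card K * indChar f (fun k => (R k).trace) (List.ofFn fun i => y (σ i)).prod) := by
  have hl : (List.ofFn fun i => indMatrix f R (y (σ i))) =
      (y (σ 0) :: List.ofFn fun i : Fin n => y (σ i.succ)).map (indMatrix f R) := by
    rw [List.ofFn_succ, List.map_cons, List.map_ofFn]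
    rfl
  rw [permTrace_eq_trace_prod σ h hσ, hl, prod_map_indMatrix, Matrix.trace_smul, trace_indMatrix,
    List.ofFn_succ (f := fun i => y (σ i)), List.length_ofFn, smul_eq_mul]

/-- The permuted product of the induced matrices depends only on the induced class function. -/
theorem permTrace_indMatrix_congr {ι' : Type*} [Fintype ι'] [DecidableEq ι'] {p : ℕ}
    [Fact p.Prime] (f : K →* G) (R : K →* Matrix ι ι ℂ) (R' : K →* Matrix ι' ι' ℂ)
    (hR : indChar f (fun k => (R k).trace) = indChar f (fun k => (R' k).trace))
    (y : Cyc p → G) (h : Cyc p) :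
    permTrace (fun q => indMatrix f R (y q)) h = permTrace (fun q => indMatrix f R' (y q)) h := by
  -- As p is prime, every h ≠ 1 generates, so a single cycle covers all factors; h = 1 has p fixed
  -- points instead and gives a product of traces.
  by_cases hh : h = 1
  · subst hh
    simp only [permTrace_one, trace_indMatrix, hR]
  · obtain ⟨n, hn⟩ : ∃ n, p = n + 1 := ⟨p - 1, (Nat.succ_pred_prime Fact.out).symm⟩
    obtain ⟨σ, hσ⟩ := exists_equiv_powers hn h hh
    rw [permTrace_indMatrix_eq σ h hσ, permTrace_indMatrix_eq σ h hσ, hR]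

end InducedMatrix

section WreathInduction

variable {K G : Type*} [Group K] [Group G]

/-- The homomorphism `K ≀ Q → G ≀ Q` induced by `f : K → G`. -/
def wreathHom (Q : Type*) [Group Q] (f : K →* G) :
    RegularWreathProduct K Q →* RegularWreathProduct G Q where
  toFun x := ⟨fun q => f (x.left q), x.right⟩
  map_one' := by ext <;> simp
  map_mul' x y := by ext <;> simp

theorem wreathHom_comp_baseHom (Q : Type*) [Group Q] (f : K →* G) :
    (wreathHom Q f).comp (baseHom K Q) = (baseHom G Q).comp (f.compLeft Q) := rfl

/-- Expanding each induced matrix entry chooses an element of K at every q, that is, some x : Q → K;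
a term survives only if all the support conditions hold. -/
theorem sum_permTrace {Q ι : Type*} [Fintype Q] [DecidableEq Q] [Group Q] [Fintype K] [Fintype G]
    [DecidableEq G] [Fintype ι] [DecidableEq ι] (f : K →* G) (R : K →* Matrix ι ι ℂ)
    (y : Q → G) (h : Q) :
    ∑ z : Q → G, ∑ x : Q → K,
      (if ∀ k, f (x k) = (z k)⁻¹ * y k * z (h⁻¹ * k) then permTrace (fun q => R (x q)) h else 0) =
      permTrace (fun q => indMatrix f R (y q)) h := by
  unfold permTrace
  rw [← (Equiv.arrowProdEquivProdArrow Q (fun _ => G) (fun _ => ι)).symm.sum_comp,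
    Fintype.sum_prod_type]
  refine Finset.sum_congr rfl fun z _ => ?_
  simp only [Equiv.arrowProdEquivProdArrow, Equiv.coe_fn_symm_mk, indMatrix, Finset.prod_univ_sum, Fintype.piFinset_univ]
  rw [Finset.sum_comm]
  refine Finset.sum_congr rfl fun x _ => ?_
  split_ifs with hx
  · simp only [hx, if_true]
  · obtain ⟨k, hk⟩ := not_forall.mp hx
    exact (Finset.sum_eq_zero fun b _ =>
      Finset.prod_eq_zero (Finset.mem_univ k) (if_neg hk)).symm

/-- The class function of `K ≀ Q` induced to `G ≀ Q` from the character `𝒳(χ; ψ)`, where `R` is a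
matrix representation with character `χ`. -/
theorem indChar_wreathHom {Q ι : Type*} [Fintype Q] [DecidableEq Q] [Group Q] [Fintype K]
    [Fintype G] [DecidableEq G] [Fintype ι] [DecidableEq ι] (f : K →* G)
    (R : K →* Matrix ι ι ℂ) (ψ : Q → ℂ) (g : RegularWreathProduct G Q) :
    indChar (wreathHom Q f) (fun x => permTrace (fun q => R (x.left q)) x.right * ψ x.right) g =
      (Nat.card (RegularWreathProduct K Q) : ℂ)⁻¹ * ∑ u : Q, ∑ h : Q,
        if h = u⁻¹ * g.right * u then
          permTrace (fun q => indMatrix f R (g.left (u * q))) h * ψ h else 0 := by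
  classical
  let _ : Fintype (RegularWreathProduct K Q) :=
    Fintype.ofEquiv _ (RegularWreathProduct.equivProd K Q).symm
  let _ : Fintype (RegularWreathProduct G Q) :=
    Fintype.ofEquiv _ (RegularWreathProduct.equivProd G Q).symm
  rw [indChar_apply]
  congr 1
  rw [← (RegularWreathProduct.equivProd G Q).symm.sum_comp, Fintype.sum_prod_type,
    Finset.sum_comm]
  refine Finset.sum_congr rfl fun u _ => ?_
  have reindex : ∀ z : Q → G, (∑ x : RegularWreathProduct K Q,
      if wreathHom Q f x = (⟨z, u⟩ : RegularWreathProduct G Q)⁻¹ * g * ⟨z, u⟩ then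
        permTrace (fun q => R (x.left q)) x.right * ψ x.right else 0) =
      ∑ h : Q, ∑ x : Q → K, if h = u⁻¹ * g.right * u then
        (if ∀ k, f (x k) = (z (u * k))⁻¹ * g.left (u * k) * z (u * (h⁻¹ * k)) then
          permTrace (fun q => R (x q)) h else 0) * ψ h else 0 := by
    intro z
    rw [← (RegularWreathProduct.equivProd K Q).symm.sum_comp, Fintype.sum_prod_type,
      Finset.sum_comm]
    refine Finset.sum_congr rfl fun h _ => Finset.sum_congr rfl fun x _ => ?_
    change (if wreathHom Q f ⟨x, h⟩ = (⟨z, u⟩ : RegularWreathProduct G Q)⁻¹ * g * ⟨z, u⟩ then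
      permTrace (fun q => R (x q)) h * ψ h else 0) = _
    by_cases hh : h = u⁻¹ * g.right * u
    · have e : wreathHom Q f ⟨x, h⟩ = (⟨z, u⟩ : RegularWreathProduct G Q)⁻¹ * g * ⟨z, u⟩ ↔
          ∀ k, f (x k) = (z (u * k))⁻¹ * g.left (u * k) * z (u * (h⁻¹ * k)) := by
        rw [RegularWreathProduct.ext_iff, funext_iff]
        simp [wreathHom, hh, mul_assoc]
      rw [if_pos hh]
      simp only [e]
      split_ifs <;> simp
    · rw [if_neg hh, if_neg]
      intro e
      exact hh (congrArg RegularWreathProduct.right e)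
  refine (Finset.sum_congr rfl fun z _ => reindex z).trans ?_
  rw [Finset.sum_comm]
  refine Finset.sum_congr rfl fun h _ => ?_
  by_cases hh : h = u⁻¹ * g.right * u
  · simp only [if_pos hh, ← Finset.sum_mul]
    congr 1
    rw [← sum_permTrace]
    -- Translating the argument of z by u matches the conjugation condition with that of
    -- `sum_permTrace`.
    exact Fintype.sum_equiv ((Equiv.mulLeft u).symm.arrowCongr (Equiv.refl G)) _ _ fun z => rfl
  · simp [hh]

end WreathInduction

section WreathCharacter

variable {K : Type*} [Group K] {m : ℕ}

/-- The matrix form of a representation on `ℂ^m`. -/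
noncomputable def matrixRep (ρ : Representation ℂ K (Fin m → ℂ)) :
    K →* Matrix (Fin m) (Fin m) ℂ :=
  (LinearMap.toMatrixAlgEquiv' : ((Fin m → ℂ) →ₗ[ℂ] (Fin m → ℂ)) ≃ₐ[ℂ] _).toMonoidHom.comp ρ

theorem trace_matrixRep (ρ : Representation ℂ K (Fin m → ℂ)) (k : K) :
    (matrixRep ρ k).trace = ρ.character k :=
  (LinearMap.trace_eq_matrix_trace ℂ (Pi.basisFun ℂ (Fin m)) (ρ k)).symm

/-- The trace is read off in the basis of pure tensors of standard basis vectors. -/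
theorem wreathChar_eq {Q : Type*} [Group Q] [Fintype Q] [DecidableEq Q]
    (ρ : Representation ℂ K (Fin m → ℂ)) (ψ : Q → ℂ) :
    wreathChar ρ ψ = fun x => permTrace (fun q => matrixRep ρ (x.left q)) x.right * ψ x.right := by
  classical
  funext x
  unfold wreathChar
  congr 1
  change LinearMap.trace ℂ _ (tensorMap ρ x) = _
  rw [LinearMap.trace_eq_matrix_trace ℂ
    (Basis.piTensorProduct fun _ : Q => Pi.basisFun ℂ (Fin m))]
  refine Finset.sum_congr rfl fun b _ => ?_
  rw [Matrix.diag_apply, LinearMap.toMatrix_apply, Basis.piTensorProduct_apply, tensorMap_tprod,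
    Basis.piTensorProduct_repr_tprod_apply]
  refine Finset.prod_congr rfl fun q _ => ?_
  simp [matrixRep]

/-- Induction to `G ≀ C_p` of `𝒳(χ; ψ)` depends only on `ψ` and the class function of `G` induced
from `χ`. -/
theorem indChar_wreathChar_congr {G : Type*} [Group G] [Finite K] [Finite G] {p : ℕ}
    [Fact p.Prime] {m' : ℕ} (f : K →* G) (ρ : Representation ℂ K (Fin m → ℂ))
    (ρ' : Representation ℂ K (Fin m' → ℂ))
    (h : indChar f ρ.character = indChar f ρ'.character) (ψ : Cyc p → ℂ) :
    indChar (wreathHom (Cyc p) f) (wreathChar ρ ψ) =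
      indChar (wreathHom (Cyc p) f) (wreathChar ρ' ψ) := by
  classical
  cases nonempty_fintype K
  cases nonempty_fintype G
  funext g
  simp only [wreathChar_eq, indChar_wreathHom]
  have hR : indChar f (fun k => (matrixRep ρ k).trace) =
      indChar f (fun k => (matrixRep ρ' k).trace) := by
    simpa only [trace_matrixRep] using h
  simp only [permTrace_indMatrix_congr f _ _ hR]

/-- The automorphism of `K ≀ Q` induced by an automorphism of `Q`. -/
def topAut (K : Type*) [Group K] {Q : Type*} [Group Q] (τ : Q ≃* Q) :
    RegularWreathProduct K Q ≃* RegularWreathProduct K Q :=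
  RegularWreathProduct.congr (MulEquiv.refl K) τ

/-- Permuting the tensor factors by τ is a change of basis and leaves the tensor power's character
alone, so only ψ is twisted. -/
theorem wreathChar_topAut {Q : Type*} [Group Q] [Finite Q]
    (ρ : Representation ℂ K (Fin m → ℂ)) (ψ : Q → ℂ) (τ : Q ≃* Q) :
    (fun x => wreathChar ρ ψ (topAut K τ x)) = wreathChar ρ fun q => ψ (τ q) := by
  classical
  cases nonempty_fintype Q
  funext x
  simp only [wreathChar_eq]
  congr 1
  exact permTrace_comp_mulEquiv (fun q => matrixRep ρ (x.left q)) τ x.right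

/-- Translating the factors of an external product does not change the class function that it
induces on the wreath product. -/
theorem indChar_baseHom_translate {Q : Type*} [Group Q] [Fintype Q] [Finite K]
    (θ : Q → K → ℂ) (s : Q) :
    indChar (baseHom K Q) (prodChar fun q => θ (s * q)) = indChar (baseHom K Q) (prodChar θ) := by
  let α : (Q → K) ≃* (Q → K) :=
    { toFun := fun x q => x (s⁻¹ * q)
      invFun := fun x q => x (s * q)
      left_inv := fun x => by simp
      right_inv := fun x => by simp
      map_mul' := fun x y => rfl }
  rw [← indChar_comp_mulEquiv (baseHom K Q) α ⟨1, s⟩ _ (prodChar θ)]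
  · congr 1
    funext x
    exact Fintype.prod_equiv (Equiv.mulLeft s) _ _ fun q => by simp [α]
  · intro x
    ext <;> simp [α, baseHom]

/-- Induction to `G ≀ Q` through the base group depends only on the induced class functions of the
factors. -/
theorem indChar_wreathHom_baseHom_congr {G Q : Type*} [Group G] [Group Q] [Fintype Q] [Finite K]
    [Finite G] (f : K →* G) {θ ζ : Q → K → ℂ} (h : ∀ q, indChar f (θ q) = indChar f (ζ q)) :
    indChar (wreathHom Q f) (indChar (baseHom K Q) (prodChar θ)) =
      indChar (wreathHom Q f) (indChar (baseHom K Q) (prodChar ζ)) := by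
  -- The base group K^Q is sent to G ≀ Q through G^Q instead of K ≀ Q.
  simp only [← indChar_comp, wreathHom_comp_baseHom]
  simp only [indChar_comp (baseHom G Q), indChar_prodChar, h]

end WreathCharacter

/-! ### The imprimitive action -/

section Imprimitive

variable {K Λ : Type*} [Group K] (Q : Type*) [Group Q]

/-- The imprimitive action of `Sym(Λ) ≀ Q` on `Λ × Q`. -/
def imprimitiveHom (Λ : Type*) : RegularWreathProduct (Equiv.Perm Λ) Q →* Equiv.Perm (Λ × Q) :=
  RegularWreathProduct.toPerm (Equiv.Perm Λ) Q Λ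

theorem imprimitiveHom_apply (w : RegularWreathProduct (Equiv.Perm Λ) Q) (x : Λ × Q) :
    imprimitiveHom Q Λ w x = (w.left (w.right * x.2) x.1, w.right * x.2) := rfl

variable {Q}

/-- The conjugating element relabels the blocks Λ × {q} by τ. It is available because the target is
the full symmetric group on Λ × Q. -/
theorem imprimitiveHom_topAut (f : K →* Equiv.Perm Λ) (τ : Q ≃* Q) (w : RegularWreathProduct K Q) :
    imprimitiveHom Q Λ (wreathHom Q f (topAut K τ w)) =
      (Equiv.prodCongr (Equiv.refl Λ) τ.toEquiv : Equiv.Perm (Λ × Q)) *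
        imprimitiveHom Q Λ (wreathHom Q f w) *
        (Equiv.prodCongr (Equiv.refl Λ) τ.toEquiv : Equiv.Perm (Λ × Q))⁻¹ := by
  rw [eq_mul_inv_iff_mul_eq]
  refine Equiv.ext fun x => ?_
  simp [imprimitiveHom_apply, wreathHom, topAut, RegularWreathProduct.congr, Equiv.Perm.mul_apply]

/-- An automorphism of the top group becomes inner in the symmetric group. -/
theorem indChar_imprimitiveHom_topAut [Finite K] [Finite Q] [Finite Λ] (f : K →* Equiv.Perm Λ)
    (τ : Q ≃* Q) (θ : RegularWreathProduct K Q → ℂ) :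
    indChar (imprimitiveHom Q Λ) (indChar (wreathHom Q f) fun x => θ (topAut K τ x)) =
      indChar (imprimitiveHom Q Λ) (indChar (wreathHom Q f) θ) := by
  rw [← indChar_comp, ← indChar_comp]
  exact indChar_comp_mulEquiv _ (topAut K τ) _ (imprimitiveHom_topAut f τ) θ

end Imprimitive

theorem iteratedWreathToPermHom_succ (p k : ℕ) :
    iteratedWreathToPermHom (Cyc p) (k + 1) =
      (Fin.succFunEquiv (Cyc p) k).symm.permCongrHom.toMonoidHom.comp
        ((imprimitiveHom (Cyc p) (Fin k → Cyc p)).comp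
          (wreathHom (Cyc p) (iteratedWreathToPermHom (Cyc p) k))) :=
  MonoidHom.ext fun _ => Equiv.ext fun _ => rfl

/-! ### Characters of the cyclic group -/

/-- An irreducible character of a commutative group is a homomorphism. -/
theorem exists_monoidHom_of_mem_Irr {G : Type*} [CommGroup G] {χ : G → ℂ} (hχ : χ ∈ Irr G) :
    ∃ f : G →* ℂ, ⇑f = χ := by
  obtain ⟨m, ρ, hρ, rfl⟩ := hχ
  have h1 : Module.finrank ℂ (Fin m → ℂ) = 1 :=
    Representation.IsIrreducible.finrank_eq_one_of_isMulCommutative ρ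
  have hm : m = 1 := by simpa using h1
  subst hm
  refine ⟨⟨⟨ρ.character, by simp [Representation.char_one]⟩, fun a b => ?_⟩, rfl⟩
  simp only [← trace_matrixRep, map_mul, Matrix.trace_fin_one, Matrix.mul_apply,
    Fin.sum_univ_one]

/-- Any two nontrivial irreducible characters of `C_p` differ by an automorphism. -/
theorem exists_mulEquiv_of_ne_one {p : ℕ} [Fact p.Prime] {χ ψ : Cyc p → ℂ}
    (hχ : χ ∈ Irr (Cyc p)) (hψ : ψ ∈ Irr (Cyc p)) (hχ1 : χ ≠ 1) (hψ1 : ψ ≠ 1) :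
    ∃ τ : Cyc p ≃* Cyc p, (fun q => χ (τ q)) = ψ := by
  obtain ⟨f, rfl⟩ := exists_monoidHom_of_mem_Irr hχ
  obtain ⟨g, rfl⟩ := exists_monoidHom_of_mem_Irr hψ
  let γ : Cyc p := Multiplicative.ofAdd 1
  have hγ : ∀ q : Cyc p, q = γ ^ (Multiplicative.toAdd q).val := by
    intro q
    apply Multiplicative.toAdd.injective
    simp [γ]
  have hγp : γ ^ p = 1 := by
    apply Multiplicative.toAdd.injective
    simp [γ]
  have hf : f γ ≠ 1 := by
    intro h
    refine hχ1 (funext fun q => ?_)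
    rw [hγ q, map_pow, h, one_pow, Pi.one_apply]
  have hg : g γ ≠ 1 := by
    intro h
    refine hψ1 (funext fun q => ?_)
    rw [hγ q, map_pow, h, one_pow, Pi.one_apply]
  have hfp : f γ ^ p = 1 := by rw [← map_pow, hγp, map_one]
  have hgp : g γ ^ p = 1 := by rw [← map_pow, hγp, map_one]
  -- Since f γ has order p, g γ = (f γ)^a for some a; the automorphism sought is q ↦ q^a, invertible
  -- because p ∣ a would force g γ = 1.
  have hprim : IsPrimitiveRoot (f γ) p := by
    have := IsPrimitiveRoot.orderOf (f γ)
    rwa [orderOf_eq_prime hfp hf] at this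
  obtain ⟨a, -, ha⟩ := hprim.eq_pow_of_pow_eq_one hgp
  have ha0 : (a : ZMod p) ≠ 0 := by
    intro h
    obtain ⟨b, rfl⟩ := (ZMod.natCast_eq_zero_iff a p).mp h
    exact hg (by rw [← ha, pow_mul, hfp, one_pow])
  refine ⟨(DistribMulAction.toAddEquiv (ZMod p) (Units.mk0 (a : ZMod p) ha0)).toMultiplicative,
    funext fun q => ?_⟩
  have hτ : (DistribMulAction.toAddEquiv (ZMod p) (Units.mk0 (a : ZMod p) ha0)).toMultiplicative q
      = q ^ a := by
    apply Multiplicative.toAdd.injective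
    simp [Units.smul_def]
  rw [hτ, hγ q, map_pow, map_pow, map_pow, ← ha, ← pow_mul, ← pow_mul, mul_comm]

/-! ### Trees -/

/-- Two labels are equal, or both lie in `[1, p - 1]`. -/
def LabelSim {p : ℕ} (ε δ : Fin (p + 1)) : Prop := ε = δ ∨ IsMiddle ε ∧ IsMiddle δ

theorem LabelSim.trans {p : ℕ} {ε δ η : Fin (p + 1)} (h : LabelSim ε δ) (h' : LabelSim δ η) :
    LabelSim ε η := by
  rcases h with rfl | h
  · exact h'
  · rcases h' with rfl | h'
    · exact Or.inr h
    · exact Or.inr ⟨h.1, h'.2⟩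

theorem not_isMiddle_last (p : ℕ) : ¬ IsMiddle (Fin.last p) := fun h => lt_irrefl _ h.2

theorem not_labelSim_castSucc_last {p : ℕ} (j : Fin p) :
    ¬ LabelSim j.castSucc (Fin.last p) := by
  rintro (h | h)
  · exact Fin.castSucc_ne_last j h
  · exact not_isMiddle_last p h.2

theorem not_labelSim_last_castSucc {p : ℕ} (j : Fin p) :
    ¬ LabelSim (Fin.last p) j.castSucc := by
  rintro (h | h)
  · exact Fin.castSucc_ne_last j h.symm
  · exact not_isMiddle_last p h.1

/-- Two trees agree up to the values of the labels in `[1, p - 1]`. -/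
inductive TreeSim {p : ℕ} : {h : ℕ} → PTree p h → PTree p h → Prop
  | leaf {ε δ : Fin (p + 1)} (h : LabelSim ε δ) : TreeSim (.leaf ε) (.leaf δ)
  | node {h : ℕ} {S S' : Cyc p → PTree p h} {ε δ : Fin (p + 1)} (hS : ∀ i, TreeSim (S i) (S' i))
      (hε : LabelSim ε δ) : TreeSim (.node S ε) (.node S' δ)

theorem TreeSim.refl {p h : ℕ} (T : PTree p h) : TreeSim T T := by
  induction T with
  | leaf ε => exact .leaf (Or.inl rfl)
  | node S ε ih => exact .node ih (Or.inl rfl)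

theorem TreeSim.trans {p h : ℕ} {T U V : PTree p h} (hTU : TreeSim T U) (hUV : TreeSim U V) :
    TreeSim T V := by
  induction hTU with
  | leaf h =>
    cases hUV with
    | leaf h' => exact .leaf (h.trans h')
  | node _ hε ih =>
    cases hUV with
    | node hS' hε' => exact .node (fun i => ih i (hS' i)) (hε.trans hε')

theorem TreeSim.of_goodReplacement {p h : ℕ} {T U : PTree p h} (hTU : GoodReplacement T U) :
    TreeSim T U := by
  induction T with
  | leaf ε =>
    cases U with
    | leaf δ => exact .leaf (Or.inr hTU)
  | node S ε ih =>
    cases U with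
    | node S' δ =>
      rcases hTU with ⟨rfl, h⟩ | ⟨rfl, i, hi, hj⟩
      · exact .node (fun i => .refl _) (Or.inr h)
      · refine .node (fun j => ?_) (Or.inl rfl)
        by_cases h : j = i
        · subst h
          exact ih j hi
        · rw [hj j h]
          exact .refl _

/-- Only the two ends of the chain are retained: the intermediate trees need not belong to
characters, so they cannot be used in the induction. -/
theorem TreeSim.of_reflTransGen {p h : ℕ} {T U : PTree p h}
    (hTU : Relation.ReflTransGen GoodReplacement T U) : TreeSim T U := by
  induction hTU with
  | refl => exact .refl _
  | tail _ h ih => exact ih.trans (.of_goodReplacement h)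

theorem PTree.act_mul {p : ℕ} : {h : ℕ} → (g g' : P p h) → (T : PTree p h) →
    PTree.act g (PTree.act g' T) = PTree.act (g * g') T
  | 0, _, _, .leaf _ => rfl
  | h + 1, g, g', .node S ε => by
    change PTree.node _ ε = PTree.node _ ε
    congr 1
    funext i
    have key := PTree.act_mul (RegularWreathProduct.left g i)
      (RegularWreathProduct.left g' ((RegularWreathProduct.right g)⁻¹ * i))
      (S ((RegularWreathProduct.right g')⁻¹ * ((RegularWreathProduct.right g)⁻¹ * i)))
    refine key.trans ?_
    rw [← mul_assoc, ← mul_inv_rev]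
    rfl

theorem act_mem_orbit {p h : ℕ} {T U : PTree p h} (g : P p h) (hU : U ∈ T.orbit) :
    PTree.act g U ∈ T.orbit := by
  obtain ⟨g', rfl⟩ := hU
  exact ⟨g * g', (PTree.act_mul g g' T).symm⟩

variable {p : ℕ} [Fact p.Prime]

/-- Needed because the subtrees of an orbit element are known only as images of the chosen S i under
the action. -/
theorem act_mem_trees (φ : Fin p ≃ Irr (Cyc p)) {h : ℕ} {θ : P p (h + 1) → ℂ} {T : PTree p h}
    (g : P p h) (hT : T ∈ trees φ h θ) : PTree.act g T ∈ trees φ h θ := by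
  cases h with
  | zero =>
    cases T
    exact hT
  | succ h =>
    rcases hT with ⟨m, ρ, j, S, h1, h2, h3, h4⟩ | ⟨θs, S, h1, h2, h3, h4, h5⟩
    · exact Or.inl ⟨m, ρ, j, S, h1, h2, h3, act_mem_orbit g h4⟩
    · exact Or.inr ⟨θs, S, h1, h2, h3, h4, act_mem_orbit g h5⟩

/-- The subtrees of a tree in the orbit of `(S; ε)` are, up to a translation of their positions,
images of the `S i`. -/
theorem exists_of_mem_orbit_node {h : ℕ} {S : Cyc p → PTree p h} {ε : Fin (p + 1)}
    {T : PTree p (h + 1)} (hT : T ∈ (PTree.node S ε).orbit) :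
    ∃ (s : Cyc p) (a : Cyc p → P p h), T = .node (fun i => PTree.act (a i) (S (s * i))) ε := by
  obtain ⟨g, rfl⟩ := hT
  exact ⟨(RegularWreathProduct.right g)⁻¹, RegularWreathProduct.left g, rfl⟩

/-! ### Induction to the symmetric group -/

/-- The embedding of the `k`-fold wreath product `C_p ≀ ⋯ ≀ C_p` in `Sym(C_p ^ k)`. -/
abbrev iterHom (p k : ℕ) : P p k →* Equiv.Perm (Fin k → Cyc p) := iteratedWreathToPermHom (Cyc p) k

theorem indChar_iterHom_succ (k : ℕ) (θ : RegularWreathProduct (P p k) (Cyc p) → ℂ) :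
    indChar (iterHom p (k + 1)) θ =
      indChar (Fin.succFunEquiv (Cyc p) k).symm.permCongrHom.toMonoidHom
        (indChar (imprimitiveHom (Cyc p) (Fin k → Cyc p))
          (indChar (wreathHom (Cyc p) (iterHom p k)) θ)) := by
  rw [← indChar_comp, ← indChar_comp]
  exact congrArg (fun f => indChar f θ) (iteratedWreathToPermHom_succ p k)

theorem indChar_iterHom_congr {k : ℕ} {θ ζ : RegularWreathProduct (P p k) (Cyc p) → ℂ}
    (h : indChar (wreathHom (Cyc p) (iterHom p k)) θ =
      indChar (wreathHom (Cyc p) (iterHom p k)) ζ) :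
    indChar (iterHom p (k + 1)) θ = indChar (iterHom p (k + 1)) ζ := by
  rw [indChar_iterHom_succ, indChar_iterHom_succ, h]

theorem indChar_iterHom_topAut (k : ℕ) (θ : RegularWreathProduct (P p k) (Cyc p) → ℂ)
    (τ : Cyc p ≃* Cyc p) :
    indChar (iterHom p (k + 1)) (fun x => θ (topAut (P p k) τ x)) =
      indChar (iterHom p (k + 1)) θ := by
  refine (indChar_iterHom_succ k _).trans (Eq.trans ?_ (indChar_iterHom_succ k θ).symm)
  exact congrArg _ (indChar_imprimitiveHom_topAut (iterHom p k) τ θ)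

/-- Labels that agree up to middle values belong to characters of `C_p` that are equal or differ by
an automorphism. -/
theorem exists_mulEquiv_of_labelSim (φ : Fin p ≃ Irr (Cyc p)) (hφ : (φ 0 : Cyc p → ℂ) = 1)
    {j j' : Fin p} (h : LabelSim j.castSucc j'.castSucc) :
    ∃ τ : Cyc p ≃* Cyc p, (fun q => (φ j : Cyc p → ℂ) (τ q)) = (φ j' : Cyc p → ℂ) := by
  rcases h with h | h
  · rw [Fin.castSucc_injective p h]
    exact ⟨MulEquiv.refl _, rfl⟩
  -- Middle labels exclude 0, the only index that φ sends to the trivial character.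
  · have key : ∀ i : Fin p, IsMiddle i.castSucc → (φ i : Cyc p → ℂ) ≠ 1 := by
      intro i hi h1
      have : i = 0 := φ.injective (Subtype.ext (h1.trans hφ.symm))
      rw [this] at hi
      simp [IsMiddle] at hi
    exact exists_mulEquiv_of_ne_one (φ j).2 (φ j').2 (key j h.1) (key j' h.2)

theorem indChar_iterHom_eq_of_treeSim (φ : Fin p ≃ Irr (Cyc p)) (hφ : (φ 0 : Cyc p → ℂ) = 1)
    {h : ℕ} {T U : PTree p h} (hTU : TreeSim T U) {θ ζ : P p (h + 1) → ℂ} (hT : T ∈ trees φ h θ)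
    (hU : U ∈ trees φ h ζ) : indChar (iterHom p (h + 1)) θ = indChar (iterHom p (h + 1)) ζ := by
  induction h with
  | zero =>
    obtain ⟨j, rfl, rfl⟩ := hT
    obtain ⟨j', rfl, rfl⟩ := hU
    cases hTU with
    | leaf h =>
      obtain ⟨τ, hτ⟩ := exists_mulEquiv_of_labelSim φ hφ h
      rw [← hτ]
      exact (indChar_iterHom_topAut 0 (fun g => (φ j : Cyc p → ℂ) g.right) τ).symm
  | succ h ih =>
    rcases hT with ⟨m, ρ, j, S, -, rfl, hS, hT⟩ | ⟨θs, S, -, -, rfl, hS, hT⟩ <;>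
    rcases hU with ⟨m', ρ', j', S', -, rfl, hS', hU⟩ | ⟨ζs, S', -, -, rfl, hS', hU⟩ <;>
    obtain ⟨s, a, rfl⟩ := exists_of_mem_orbit_node hT <;>
    obtain ⟨s', a', rfl⟩ := exists_of_mem_orbit_node hU <;>
    cases hTU with
    | node hSS hε => ?_
    -- All subtrees under each root belong to one character, so comparing position 1 suffices,
    -- whatever the shifts s and s'.
    · have hρ := ih (hSS 1) (act_mem_trees φ _ (hS _)) (act_mem_trees φ _ (hS' _))
      obtain ⟨τ, hτ⟩ := exists_mulEquiv_of_labelSim φ hφ hε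
      rw [← hτ, ← wreathChar_topAut]
      exact (indChar_iterHom_congr (indChar_wreathChar_congr _ ρ ρ' hρ _)).trans
        (indChar_iterHom_topAut (h + 1) _ τ).symm
    -- Label p is similar only to itself, so characters of different types never have similar trees.
    · exact absurd hε (not_labelSim_castSucc_last j)
    · exact absurd hε (not_labelSim_last_castSucc j')
    · have hi : ∀ i, indChar (iterHom p (h + 1)) (θs (s * i)) =
          indChar (iterHom p (h + 1)) (ζs (s' * i)) := fun i =>
        ih (hSS i) (act_mem_trees φ _ (hS _)) (act_mem_trees φ _ (hS' _))
      -- Shifting both families by the translations of their orbit representatives aligns the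
      -- factors position by position.
      rw [← indChar_baseHom_translate θs s, ← indChar_baseHom_translate ζs s']
      exact indChar_iterHom_congr (indChar_wreathHom_baseHom_congr _ hi)

/-- Induction along `sylowHom e` factors through `Sym(C_p ^ k)`. -/
theorem indChar_sylowHom {k : ℕ} (e : (Fin k → Cyc p) ≃ Fin (p ^ k)) (θ : P p k → ℂ) :
    indChar (sylowHom e) θ = indChar e.permCongrHom.toMonoidHom (indChar (iterHom p k) θ) :=
  indChar_comp _ _ θ

end SylowTrees

theorem mainTheorem10 (p : ℕ) [Fact p.Prime]
    (φ : Fin p ≃ SylowTrees.Irr (SylowTrees.Cyc p))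
    (hφ : (φ 0 : SylowTrees.Cyc p → ℂ) = 1)
    (h : ℕ) (e : (Fin (h + 1) → SylowTrees.Cyc p) ≃ Fin (p ^ (h + 1)))
    (θ ζ : SylowTrees.P p (h + 1) → ℂ)
    (hθ : θ ∈ SylowTrees.Irr (SylowTrees.P p (h + 1)))
    (hζ : ζ ∈ SylowTrees.Irr (SylowTrees.P p (h + 1)))
    (hθζ : SylowTrees.LabelEquiv φ θ ζ) :
    SylowTrees.indChar (SylowTrees.sylowHom e) θ = SylowTrees.indChar (SylowTrees.sylowHom e) ζ ∧
      SylowTrees.Omega (SylowTrees.sylowHom e) θ =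
        SylowTrees.Omega (SylowTrees.sylowHom e) ζ := by
  obtain ⟨T, hT, U, hU, hTU⟩ := hθζ
  have key : SylowTrees.indChar (SylowTrees.sylowHom e) θ =
      SylowTrees.indChar (SylowTrees.sylowHom e) ζ := by
    rw [SylowTrees.indChar_sylowHom, SylowTrees.indChar_sylowHom,
      SylowTrees.indChar_iterHom_eq_of_treeSim φ hφ (.of_reflTransGen hTU) hT hU]
  exact ⟨key, SylowTrees.Omega_congr _ key⟩
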